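/- Let $(\tilde A,\tilde\omega)$, $(A,\omega)$ be the coefficients of an $s$-stage diagonally implicit IMEX Runge–Kutta method, i.e. $\tilde a_{ij}=0$ for $j\ge i$ and $a_{ij}=0$ for $j>i$. For $\dot y=F(y)+G(y)$ the method is $$Y^{(i)}=y_n+h\sum_j\tilde a_{ij}F(Y^{(j)})+h\sum_j a_{ij}G(Y^{(j)}),\qquad y_{n+1}=y_n+h\sum_i\tilde\omega_iF(Y^{(i)})+h\sum_i\omega_iG(Y^{(i)}).$$ A one-step method has order $p$ for an equation $\dot z=V(z)$ if for every initial value $z_0$ and every exact solution $z$ with $z(0)=z_0$ there are a neighbourhood $N$ of $(z_0,\dots,z_0)$ and constants $h_0>0$, $C$ such that for all $0<h\le h_0$ the stage equations have a solution in $N$, and every solution in $N$ gives $\|z(h)-z_1\|\le C\,h^{p+1}$. The IMEX method has order $p$ if this holds for $\dot y=F(y)+G(y)$ for all $n$ and all $C^\infty$ functions $F,G:\mathbb R^n\to\mathbb R^n$. Suppose $\omega_i=\tilde\omega_i\neq0$ for all $i$, and put $$\tilde\alpha_{ij}=\tilde\omega_j-\tfrac{\tilde\omega_j}{\tilde\omega_i}\tilde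 a_{ji},\quad \alpha_{ij}=\omega_j-\tfrac{\omega_j}{\tilde\omega_i}\tilde a_{ji},\quad \tilde\beta_{ij}=\tilde\omega_j-\tfrac{\tilde\omega_j}{\omega_i}a_{ji},\quad \beta_{ij}=\omega_j-\tfrac{\omega_j}{\omega_i}a_{ji},$$ $$d_j=\sum_i\omega_i\tilde a_{ij},\qquad e_j=\sum_i\omega_ia_{ij}.$$ Assume that the IMEX method has order $3$ and that $$\sum_i\frac{d_i^2}{\omega_i}=\frac13,\qquad \sum_i\frac{e_i^2}{\omega_i}=\frac13,\qquad \sum_i\frac{d_ie_i}{\omega_i}=\frac13 .$$ Consider, for $y,\tilde p,p\in\mathbb R^n$ and $u\in\mathbb R^m$, the extended Hamiltonian system $$\dot y=f(y,u)+g(y,u),\qquad \dot{\tilde p}=\dot p=-f_y(y,u)^T\tilde p-g_y(y,u)^Tp,\qquad u=\varphi(y,\tilde p,p),$$ where the control has been eliminated by a control law $\varphi$ (for instance the one obtained by solving $f_u^T\tilde p+g_u^Tp=0$ for $u$), and the additive Runge–Kutta method with $u^i=\varphi(Y^{(i)},\tilde P^{(i)},P^{(i)})$, $f^{(i)}=f(Y^{(i)},u^i)$,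 $f_y^{(i)}=f_y(Y^{(i)},u^i)$ (similarly for $g$): $$Y^{(i)}=y_n+h\sum_j\tilde a_{ij}f^{(j)}+h\sum_ja_{ij}g^{(j)},$$ $$\tilde P^{(i)}=\tilde p_n-h\sum_j\tilde\alpha_{ij}(f_y^{(j)})^T\tilde P^{(j)}-h\sum_j\alpha_{ij}(g_y^{(j)})^TP^{(j)},$$ $$P^{(i)}=p_n-h\sum_j\tilde\beta_{ij}(f_y^{(j)})^T\tilde P^{(j)}-h\sum_j\beta_{ij}(g_y^{(j)})^TP^{(j)},$$ $$y_{n+1}=y_n+h\sum_i\tilde\omega_if^{(i)}+h\sum_i\omega_ig^{(i)},$$ $$\tilde p_{n+1}=\tilde p_n-h\sum_i\tilde\omega_i(f_y^{(i)})^T\tilde P^{(i)}-h\sum_i\omega_i(g_y^{(i)})^TP^{(i)},$$ $$p_{n+1}=p_n-h\sum_i\tilde\omega_i(f_y^{(i)})^T\tilde P^{(i)}-h\sum_i\omega_i(g_y^{(i)})^TP^{(i)}.$$ (When $\tilde p_0=p_0$ one has $\tilde p_n=p_n$ for all $n$.) Then this method has order $3$ for the extended system, for all $n,m$: the order condition holds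 at every initial value $z_0=(y_0,\tilde p_0,p_0)$ near which $\varphi$ is of class $C^3$, and such that $f,g$ are of class $C^4$ near $(y_0,\varphi(z_0))$. -/

import Mathlib

open scoped ContDiff

noncomputable section

namespace ImexOrder

/-- The Euclidean space `ℝⁿ`. -/
abbrev Vec (n : ℕ) := EuclideanSpace ℝ (Fin n)

/-- Coefficients of an implicit-explicit Runge-Kutta method with `s` stages: `aE`, `wE` are the
matrix and weights used for `f` (written `ã`, `ω̃` in the text), and `aI`, `wI` are the matrix
and weights used for `g` (written `a`, `ω`). -/
structure ImexRK (s : ℕ) where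
  aE : Fin s → Fin s → ℝ
  aI : Fin s → Fin s → ℝ
  wE : Fin s → ℝ
  wI : Fin s → ℝ

/-- A one-step method with `s` stages in a state space `Z` is given by its stage equations
`Stages h σ` and its update `step h σ`, for a step of size `h` from `z₀` with stages `σ`.
`HasLocalOrder p V z₀ Stages step` says that it has order (at least) `p` at `z₀` for the equation
`ż = V z`. That is, for every exact solution `z` with `z 0 = z₀` there is a neighbourhood of
`(z₀, …, z₀)` in which, for all small `h > 0`, the stage equations are solvable, and every solution
in it gives a local error `‖z(h) - z₁‖ ≤ C h ^ (p + 1)`. -/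
def HasLocalOrder {Z : Type} [NormedAddCommGroup Z] [NormedSpace ℝ Z] {s : ℕ}
    (p : ℕ) (V : Z → Z) (z₀ : Z)
    (Stages : ℝ → (Fin s → Z) → Prop) (step : ℝ → (Fin s → Z) → Z) : Prop :=
  ∀ (τ : ℝ) (z : ℝ → Z), 0 < τ → z 0 = z₀ →
    (∀ t ∈ Set.Icc (0 : ℝ) τ, HasDerivWithinAt z (V (z t)) (Set.Icc (0 : ℝ) τ) t) →
    ∃ r h₀ C : ℝ, 0 < r ∧ 0 < h₀ ∧ h₀ ≤ τ ∧ ∀ h : ℝ, 0 < h → h ≤ h₀ →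
      (∃ σ ∈ Metric.closedBall (fun _ : Fin s => z₀) r, Stages h σ) ∧
      ∀ σ ∈ Metric.closedBall (fun _ : Fin s => z₀) r, Stages h σ →
        ‖z h - step h σ‖ ≤ C * h ^ (p + 1)

/-- The extended state `(y, p̃, p)`. -/
abbrev Ext (n : ℕ) := Vec n × Vec n × Vec n

/-- `jacT f y u p = f_y(y, u)ᵀ p`, where `f_y` is the partial derivative in the first variable. -/
def jacT {n m : ℕ} (f : Vec n → Vec m → Vec n) (y : Vec n) (u : Vec m) (p : Vec n) : Vec n :=
  ContinuousLinearMap.adjoint (fderiv ℝ (fun x => f x u) y) p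

/-- Right-hand side of the extended Hamiltonian system in the variables `z = (y, p̃, p)`,
with the control `u = φ(y, p̃, p)`:
`ẏ = f(y,u) + g(y,u)`, and `p̃' = p' = - f_y(y,u)ᵀ p̃ - g_y(y,u)ᵀ p`. -/
def extField {n m : ℕ} (f g : Vec n → Vec m → Vec n) (φ : Ext n → Vec m) (z : Ext n) : Ext n :=
  (f z.1 (φ z) + g z.1 (φ z),
   - jacT f z.1 (φ z) z.2.1 - jacT g z.1 (φ z) z.2.2,
   - jacT f z.1 (φ z) z.2.1 - jacT g z.1 (φ z) z.2.2)

namespace ImexRK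

variable {s : ℕ} (M : ImexRK s)

/-- Explicit (strictly lower triangular) in `f`, diagonally implicit (lower triangular) in `g`. -/
def DiagonallyImplicit : Prop :=
  (∀ i j : Fin s, i ≤ j → M.aE i j = 0) ∧ (∀ i j : Fin s, i < j → M.aI i j = 0)

/-- Stage equations of the IMEX method for `ẏ = F(y) + G(y)`. -/
def StateStages {n : ℕ} (F G : Vec n → Vec n) (y₀ : Vec n) (h : ℝ) (Y : Fin s → Vec n) : Prop :=
  ∀ i, Y i = y₀ + h • ∑ j, M.aE i j • F (Y j) + h • ∑ j, M.aI i j • G (Y j)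

/-- Update of the IMEX method for `ẏ = F(y) + G(y)`. -/
def stateStep {n : ℕ} (F G : Vec n → Vec n) (y₀ : Vec n) (h : ℝ) (Y : Fin s → Vec n) : Vec n :=
  y₀ + h • ∑ i, M.wE i • F (Y i) + h • ∑ i, M.wI i • G (Y i)

/-- The IMEX method has order `p`: its local error is `O(h ^ (p + 1))` for all smooth additively
split equations `ẏ = F(y) + G(y)`, in every dimension and for every initial value. -/
def HasOrder (p : ℕ) : Prop :=
  ∀ (n : ℕ) (F G : Vec n → Vec n), ContDiff ℝ ∞ F → ContDiff ℝ ∞ G → ∀ y₀ : Vec n,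
    HasLocalOrder p (fun y => F y + G y) y₀ (M.StateStages F G y₀) (M.stateStep F G y₀)

/-- The coefficients `α̃`. -/
def alphaE (i j : Fin s) : ℝ := M.wE j - M.wE j / M.wE i * M.aE j i

/-- The coefficients `α`. -/
def alphaI (i j : Fin s) : ℝ := M.wI j - M.wI j / M.wE i * M.aE j i

/-- The coefficients `β̃`. -/
def betaE (i j : Fin s) : ℝ := M.wE j - M.wE j / M.wI i * M.aI j i

/-- The coefficients `β`. -/
def betaI (i j : Fin s) : ℝ := M.wI j - M.wI j / M.wI i * M.aI j i

/-- `d_j = ∑ i, ω_i ã_ij`. -/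
def d (j : Fin s) : ℝ := ∑ i, M.wI i * M.aE i j

/-- `e_j = ∑ i, ω_i a_ij`. -/
def e (j : Fin s) : ℝ := ∑ i, M.wI i * M.aI i j

/-- Stage equations of the additive method for the extended system, for a step of size `h` from
`z₀ = (y₀, p̃₀, p₀)`; the `i`-th stage is `σ i = (Y i, P̃ i, P i)`, and the stage control is
`u i = φ(Y i, P̃ i, P i)`. The scheme keeps `p̃ₙ = pₙ` when `p̃₀ = p₀`, and
then `z₀.2.1` in the second equation is `pₙ`. -/
def ExtStages {n m : ℕ} (f g : Vec n → Vec m → Vec n) (φ : Ext n → Vec m)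
    (z₀ : Ext n) (h : ℝ) (σ : Fin s → Ext n) : Prop :=
  ∀ i,
    (σ i).1 = z₀.1 + h • ∑ j, M.aE i j • f (σ j).1 (φ (σ j))
      + h • ∑ j, M.aI i j • g (σ j).1 (φ (σ j)) ∧
    (σ i).2.1 = z₀.2.1 - h • ∑ j, M.alphaE i j • jacT f (σ j).1 (φ (σ j)) (σ j).2.1
      - h • ∑ j, M.alphaI i j • jacT g (σ j).1 (φ (σ j)) (σ j).2.2 ∧
    (σ i).2.2 = z₀.2.2 - h • ∑ j, M.betaE i j • jacT f (σ j).1 (φ (σ j)) (σ j).2.1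
      - h • ∑ j, M.betaI i j • jacT g (σ j).1 (φ (σ j)) (σ j).2.2

/-- Update `(y₁, p̃₁, p₁)` of the additive method for the extended system. -/
def extStep {n m : ℕ} (f g : Vec n → Vec m → Vec n) (φ : Ext n → Vec m)
    (z₀ : Ext n) (h : ℝ) (σ : Fin s → Ext n) : Ext n :=
  (z₀.1 + h • ∑ i, M.wE i • f (σ i).1 (φ (σ i)) + h • ∑ i, M.wI i • g (σ i).1 (φ (σ i)),
   z₀.2.1 - h • ∑ i, M.wE i • jacT f (σ i).1 (φ (σ i)) (σ i).2.1
     - h • ∑ i, M.wI i • jacT g (σ i).1 (φ (σ i)) (σ i).2.2,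
   z₀.2.2 - h • ∑ i, M.wE i • jacT f (σ i).1 (φ (σ i)) (σ i).2.1
     - h • ∑ i, M.wI i • jacT g (σ i).1 (φ (σ i)) (σ i).2.2)

/-- The additive method has order `p` for the extended Hamiltonian system: its local error is
`O(h ^ (p + 1))` at every initial value `z₀`, for all `f`, `g` of class `C ^ (p + 1)` and all
control laws `φ` of class `C ^ p` (this makes `extField f g φ` of class `C ^ p`). Smoothness is
only needed near `z₀`, so locally defined `f`, `g`, `φ` are included. -/
def ExtHasOrder (p : ℕ) : Prop :=
  ∀ (n m : ℕ) (f g : Vec n → Vec m → Vec n) (φ : Ext n → Vec m) (z₀ : Ext n),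
    ContDiffAt ℝ (p + 1) (fun x : Vec n × Vec m => f x.1 x.2) (z₀.1, φ z₀) →
    ContDiffAt ℝ (p + 1) (fun x : Vec n × Vec m => g x.1 x.2) (z₀.1, φ z₀) →
    ContDiffAt ℝ p φ z₀ →
    HasLocalOrder p (extField f g φ) z₀ (M.ExtStages f g φ z₀) (M.extStep f g φ z₀)

end ImexRK

end ImexOrder

end

/-!
The method for the extended system is an additive Runge-Kutta method with four coefficient
matrices and, because `ω = ω̃`, a single vector of weights `ω`: the matrices `ã` and `a` act on the
state, and their adjoints `ω_j - ω_j ã_ji / ω_i` and `ω_j - ω_j a_ji / ω_i` on `p̃` and `p`. For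
common weights the order conditions up to order three (`OrderThree`) are indexed by rooted trees
whose non-root vertices carry one of the matrices as a colour.

Three facts give the theorem.

* An IMEX method of order three satisfies these conditions for the two matrices `ã` and `a`
  (`ImexRK.HasOrder.orderThree`), as one sees from a polynomial test equation that the method
  solves explicitly.
* The row sums of an adjoint matrix are `1 - d_i / ω_i`, and its columns weighted by `ω` sum to
  `ω_j (1 - c_j)`, where `c_j` is the row sum of the original matrix. Hence every condition
  involving adjoint matrices reduces to conditions on `ã` and `a` and to the values of
  `∑ d_i² / ω_i`, `∑ d_i e_i / ω_i` and `∑ e_i² / ω_i`, all assumed to be `1 / 3`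
  (`OrderThree.sum_elim_adjointCoeff`).
* The conditions suffice for `C³` vector fields (`OrderThree.hasLocalOrder`). The stages exist by
  contraction. Inserting expansions into the stage equations repeatedly yields the expansion of an
  arbitrary solution near the initial value, and the update then agrees up to `O(h⁴)` with the exact
  solution, which is expanded in the same way from its differential equation. All estimates are
  `O`-statements along the filter of pairs of a step size and a stage solution.
-/

namespace ImexOrder

open Filter Topology Asymptotics

/-! ### Taylor expansion of second order in normed spaces -/

section Taylor

variable {E F : Type*} [NormedAddCommGroup E] [NormedSpace ℝ E]
  [NormedAddCommGroup F] [NormedSpace ℝ F]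

/-- If the derivative of `R` is `O(‖x - x₀‖ᵏ)` and `R x₀ = 0`, then `R` is `O(‖x - x₀‖ᵏ⁺¹)`, by the
mean value inequality. -/
theorem isBigO_norm_pow_succ_of_hasFDerivAt {R : E → F} {R' : E → E →L[ℝ] F} {x₀ : E} {k : ℕ}
    (hR : ∀ᶠ x in 𝓝 x₀, HasFDerivAt R (R' x) x) (h0 : R x₀ = 0)
    (hR' : R' =O[𝓝 x₀] fun x => ‖x - x₀‖ ^ k) :
    R =O[𝓝 x₀] fun x => ‖x - x₀‖ ^ (k + 1) := by
  obtain ⟨C, hC0, hC⟩ := hR'.exists_nonneg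
  obtain ⟨ε, hε, hball⟩ := Metric.eventually_nhds_iff_ball.1 (hR.and hC.bound)
  refine IsBigO.of_bound C ?_
  filter_upwards [Metric.ball_mem_nhds x₀ hε] with x hx
  have hseg : segment ℝ x₀ x ⊆ Metric.ball x₀ ε :=
    (convex_ball x₀ ε).segment_subset (Metric.mem_ball_self hε) hx
  have key := (convex_segment (𝕜 := ℝ) x₀ x).norm_image_sub_le_of_norm_hasFDerivWithin_le
    (f := R) (f' := R') (C := C * ‖x - x₀‖ ^ k)
    (fun y hy => (hball y (hseg hy)).1.hasFDerivWithinAt) (fun y hy => ?_)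
    (left_mem_segment ℝ x₀ x) (right_mem_segment ℝ x₀ x)
  · rw [h0, sub_zero] at key
    rwa [norm_pow, norm_norm, pow_succ, ← mul_assoc]
  · have h1 := (hball y (hseg hy)).2
    rw [norm_pow, norm_norm] at h1
    have h2 : ‖y - x₀‖ ≤ ‖x - x₀‖ := by
      rw [segment_eq_image'] at hy
      obtain ⟨t, ht, rfl⟩ := hy
      simp only [add_sub_cancel_left, norm_smul, Real.norm_eq_abs, abs_of_nonneg ht.1]
      exact mul_le_of_le_one_left (norm_nonneg _) ht.2
    exact h1.trans (by gcongr)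

theorem isBigO_taylor_one {V : E → F} {x₀ : E} (hV : ContDiffAt ℝ 2 V x₀) :
    (fun x => V x - V x₀ - fderiv ℝ V x₀ (x - x₀)) =O[𝓝 x₀] fun x => ‖x - x₀‖ ^ 2 := by
  refine isBigO_norm_pow_succ_of_hasFDerivAt (k := 1)
    (R' := fun x => fderiv ℝ V x - fderiv ℝ V x₀) ?_ (by simp) ?_
  · filter_upwards [hV.eventually (by simp)] with x hx
    exact ((hx.differentiableAt (by simp)).hasFDerivAt.sub_const _).sub
      ((fderiv ℝ V x₀).hasFDerivAt.comp x ((hasFDerivAt_id x).sub_const x₀))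
  · have h := (hV.fderiv_right (m := 1) (by norm_num)).differentiableAt (by simp)
    simpa using h.isBigO_sub.norm_right

theorem isBigO_taylor_two {V : E → F} {x₀ : E} (hV : ContDiffAt ℝ 3 V x₀) :
    (fun x => V x - V x₀ - fderiv ℝ V x₀ (x - x₀)
      - (1 / 2 : ℝ) • fderiv ℝ (fderiv ℝ V) x₀ (x - x₀) (x - x₀))
      =O[𝓝 x₀] fun x => ‖x - x₀‖ ^ 3 := by
  refine isBigO_norm_pow_succ_of_hasFDerivAt (k := 2)
    (R' := fun x => fderiv ℝ V x - fderiv ℝ V x₀ - fderiv ℝ (fderiv ℝ V) x₀ (x - x₀)) ?_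
    (by simp) (isBigO_taylor_one (hV.fderiv_right (by norm_num)))
  have hsymm := hV.isSymmSndFDerivAt (by norm_num [minSmoothness_of_isRCLikeNormedField])
  filter_upwards [hV.eventually (by simp)] with x hx
  have hlin : HasFDerivAt (fun y => y - x₀) (ContinuousLinearMap.id ℝ E) x :=
    (hasFDerivAt_id x).sub_const x₀
  have hq := ((fderiv ℝ (fderiv ℝ V) x₀).hasFDerivAt.comp x hlin).clm_apply hlin
  refine ((((hx.differentiableAt (by simp)).hasFDerivAt.sub_const (V x₀)).fun_sub
    ((fderiv ℝ V x₀).hasFDerivAt.comp x hlin)).fun_sub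
      (hq.const_smul (1 / 2 : ℝ))).congr_fderiv ?_
  ext v
  have h2 : fderiv ℝ (fderiv ℝ V) x₀ v (x - x₀) = fderiv ℝ (fderiv ℝ V) x₀ (x - x₀) v :=
    hsymm v (x - x₀)
  simp only [Function.comp_apply, sub_apply, smul_apply, add_apply, ContinuousLinearMap.comp_apply,
    ContinuousLinearMap.id_apply, ContinuousLinearMap.flip_apply, h2]
  module

end Taylor

/-! ### Inserting an expansion into a vector field

For quantities `x t` depending on a parameter `t` along a filter on which the step size `h t` tends
to `0`, an expansion of `x` in powers of `h` gives one of `V ∘ x`. -/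

theorem tendsto_of_sub_isBigO {α Z : Type*} [NormedAddCommGroup Z] {l : Filter α} {h : α → ℝ}
    {x : α → Z} {z₀ : Z} (hh : Tendsto h l (𝓝 0)) (hx : (fun t => x t - z₀) =O[l] h) :
    Tendsto x l (𝓝 z₀) :=
  tendsto_sub_nhds_zero_iff.1 (hx.trans_tendsto hh)

section Expansion

variable {α Z W : Type*} [NormedAddCommGroup Z] [NormedSpace ℝ Z]
  [NormedAddCommGroup W] [NormedSpace ℝ W]
  {l : Filter α} {h : α → ℝ} {x : α → Z} {z₀ a b : Z} {V : Z → W}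

theorem isBigO_smul_const (v : W) (k : ℕ) :
    (fun t => h t ^ k • v) =O[l] fun t => h t ^ k := by
  simpa using (isBigO_refl (fun t => h t ^ k) l).smul (isBigO_refl (fun _ => v) l |>.trans
    (isBigO_const_const v (one_ne_zero (α := ℝ)) l))

theorem isBigO_pow_of_le (hh : Tendsto h l (𝓝 0)) {j k : ℕ} (hjk : j ≤ k) :
    (fun t => h t ^ k) =O[l] fun t => h t ^ j := by
  obtain ⟨i, rfl⟩ := Nat.exists_eq_add_of_le hjk
  have h1 : (fun t => h t ^ i) =O[l] fun _ => (1 : ℝ) := (hh.pow i).isBigO_one ℝ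
  simpa [pow_add] using (isBigO_refl (fun t => h t ^ j) l).mul h1

theorem expansion_zero (hh : Tendsto h l (𝓝 0)) (hV : ContDiffAt ℝ 1 V z₀)
    (hx : (fun t => x t - z₀) =O[l] h) :
    (fun t => V (x t) - V z₀) =O[l] h :=
  ((hV.differentiableAt (by simp)).isBigO_sub.comp_tendsto
    (tendsto_of_sub_isBigO hh hx)).trans hx

theorem expansion_one (hh : Tendsto h l (𝓝 0)) (hV : ContDiffAt ℝ 2 V z₀)
    (hx : (fun t => x t - z₀ - h t • a) =O[l] fun t => h t ^ 2) :
    (fun t => V (x t) - V z₀ - h t • fderiv ℝ V z₀ a) =O[l] fun t => h t ^ 2 := by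
  have hx1 : (fun t => x t - z₀) =O[l] h := by
    have h2 := (hx.trans (isBigO_pow_of_le hh one_le_two)).add
      (isBigO_smul_const (l := l) (h := h) a 1)
    simpa using h2
  have h1 := (isBigO_taylor_one hV).comp_tendsto (tendsto_of_sub_isBigO hh hx1)
  have h2 := h1.trans (hx1.norm_left.pow 2)
  have h3 := ((fderiv ℝ V z₀).isBigO_comp _ l).trans hx
  refine (h2.add h3).congr_left fun t => ?_
  simp only [Function.comp, map_sub, map_smul]
  abel

theorem expansion_two (hh : Tendsto h l (𝓝 0)) (hV : ContDiffAt ℝ 3 V z₀)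
    (hx : (fun t => x t - z₀ - h t • a - h t ^ 2 • b) =O[l] fun t => h t ^ 3) :
    (fun t => V (x t) - V z₀ - h t • fderiv ℝ V z₀ a - h t ^ 2 •
      (fderiv ℝ V z₀ b + (1 / 2 : ℝ) • fderiv ℝ (fderiv ℝ V) z₀ a a))
      =O[l] fun t => h t ^ 3 := by
  have hx2 : (fun t => x t - z₀ - h t • a) =O[l] fun t => h t ^ 2 := by
    have h2 := (hx.trans (isBigO_pow_of_le hh (show 2 ≤ 3 by norm_num))).add
      (isBigO_smul_const (l := l) (h := h) b 2)
    simpa using h2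
  have hx1 : (fun t => x t - z₀) =O[l] h := by
    have h2 := (hx2.trans (isBigO_pow_of_le hh one_le_two)).add
      (isBigO_smul_const (l := l) (h := h) a 1)
    simpa using h2
  have h1 := (isBigO_taylor_two hV).comp_tendsto (tendsto_of_sub_isBigO hh hx1)
  have h2 := h1.trans (hx1.norm_left.pow 3)
  have h3 := ((fderiv ℝ V z₀).isBigO_comp _ l).trans hx
  set B := fderiv ℝ (fderiv ℝ V) z₀
  have hB : ∀ {u v : α → Z} {p q : ℕ}, (u =O[l] fun t => h t ^ p) → (v =O[l] fun t => h t ^ q) →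
      (fun t => B (u t) (v t)) =O[l] fun t => h t ^ (p + q) := by
    intro u v p q hu hv
    simp only [pow_add]
    refine IsBigO.trans (IsBigO.of_bound ‖B‖ (Eventually.of_forall fun t => ?_))
      (hu.norm_left.mul hv.norm_left)
    rw [Real.norm_of_nonneg (by positivity), ← mul_assoc]
    exact B.le_opNorm₂ _ _
  -- The quadratic terms differ by one half of
  -- `B(x - z₀ - h a, x - z₀) + B(h a, x - z₀ - h a)`.
  have h4 := hB hx2 (q := 1) (hx1.trans (by simpa using isBigO_refl h l))
  have h5 := hB (isBigO_smul_const (l := l) (h := h) a 1) hx2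
  refine (h2.add (h3.add ((h4.add h5).const_smul_left (1 / 2 : ℝ)))).congr_left fun t => ?_
  simp only [Function.comp, map_sub, map_smul, sub_apply,
    smul_apply, smul_add, smul_sub, smul_smul, Pi.smul_apply, pow_one, pow_two]
  module

end Expansion

/-! ### The exact solution -/

section Integration

variable {Z : Type*} [NormedAddCommGroup Z] [NormedSpace ℝ Z]

theorem isBigO_pow_succ_of_hasDerivWithinAt {τ : ℝ} (hτ : 0 < τ) {g g' : ℝ → Z} {k : ℕ}
    (hg : ∀ t ∈ Set.Icc (0 : ℝ) τ, HasDerivWithinAt g (g' t) (Set.Icc (0 : ℝ) τ) t)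
    (h0 : g 0 = 0) (hg' : g' =O[𝓝[≥] 0] fun t => t ^ k) :
    g =O[𝓝[≥] 0] fun t => t ^ (k + 1) := by
  obtain ⟨C, hC0, hC⟩ := hg'.exists_nonneg
  obtain ⟨ε, hε, hs⟩ := Metric.mem_nhdsWithin_iff.1 hC.bound
  refine IsBigO.of_bound C ?_
  filter_upwards [self_mem_nhdsWithin, mem_nhdsWithin_of_mem_nhds (Metric.ball_mem_nhds (0 : ℝ) hε),
    mem_nhdsWithin_of_mem_nhds (Iio_mem_nhds hτ)] with t ht htε htτ
  rw [Set.mem_Ici] at ht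
  rw [Set.mem_Iio] at htτ
  rw [Metric.mem_ball, dist_zero_right, Real.norm_of_nonneg ht] at htε
  have key := norm_image_sub_le_of_norm_deriv_le_segment' (f := g) (f' := g') (a := 0) (b := t)
    (C := C * t ^ k)
    (fun u hu => (hg u ⟨hu.1, hu.2.trans htτ.le⟩).mono (Set.Icc_subset_Icc_right htτ.le))
    (fun u hu => ?_) t (Set.right_mem_Icc.2 ht)
  · rw [h0, sub_zero, sub_zero] at key
    rwa [Real.norm_of_nonneg (by positivity), pow_succ, ← mul_assoc]
  · have hu' : u ∈ Metric.ball (0 : ℝ) ε ∩ Set.Ici 0 :=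
      ⟨by rw [Metric.mem_ball, dist_zero_right, Real.norm_of_nonneg hu.1]; linarith [hu.2], hu.1⟩
    have h1 : ‖g' u‖ ≤ C * ‖u ^ k‖ := hs hu'
    rw [Real.norm_of_nonneg (pow_nonneg hu.1 k)] at h1
    exact h1.trans (mul_le_mul_of_nonneg_left (pow_le_pow_left₀ hu.1 hu.2.le k) hC0)

/-- The third order Taylor expansion of a solution of `ż = V z`. Each order is obtained from the
previous one by inserting it into `V` and integrating, so no regularity of `z` beyond its being a
solution is needed. -/
theorem exact_expansion {V : Z → Z} {z₀ : Z} (hV : ContDiffAt ℝ 3 V z₀) {τ : ℝ} (hτ : 0 < τ)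
    {z : ℝ → Z} (hz0 : z 0 = z₀)
    (hz : ∀ t ∈ Set.Icc (0 : ℝ) τ, HasDerivWithinAt z (V (z t)) (Set.Icc (0 : ℝ) τ) t) :
    (fun t => z t - z₀ - t • V z₀ - t ^ 2 • (1 / 2 : ℝ) • fderiv ℝ V z₀ (V z₀)
      - t ^ 3 • (1 / 6 : ℝ) • (fderiv ℝ V z₀ (fderiv ℝ V z₀ (V z₀))
        + fderiv ℝ (fderiv ℝ V) z₀ (V z₀) (V z₀))) =O[𝓝[≥] 0] fun t => t ^ 4 := by
  have hid : Tendsto (fun t : ℝ => t) (𝓝[≥] 0) (𝓝 0) := tendsto_nhdsWithin_of_tendsto_nhds tendsto_id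
  have hpow : ∀ (k : ℕ) (v : Z) (t : ℝ),
      HasDerivWithinAt (fun t : ℝ => t ^ (k + 1) • v) (((k + 1 : ℕ) * t ^ k : ℝ) • v)
        (Set.Icc (0 : ℝ) τ) t := fun k v t => by
    simpa using ((hasDerivAt_pow (k + 1) t).smul_const v).hasDerivWithinAt
  have hd0 : ∀ t ∈ Set.Icc (0 : ℝ) τ, HasDerivWithinAt (fun t => z t - z₀) (V (z t))
      (Set.Icc (0 : ℝ) τ) t := fun t ht => (hz t ht).sub_const z₀
  have hzt : Tendsto z (𝓝[≥] 0) (𝓝 z₀) := by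
    have h1 := (hz 0 ⟨le_rfl, hτ.le⟩).continuousWithinAt
    rw [ContinuousWithinAt, hz0, nhdsWithin_Icc_eq_nhdsGE hτ] at h1
    exact h1
  have e0 : (fun t => z t - z₀) =O[𝓝[≥] 0] fun t => t := by
    simpa using isBigO_pow_succ_of_hasDerivWithinAt hτ (k := 0) hd0 (by simp [hz0])
      (by simpa using (hV.continuousAt.tendsto.comp hzt).isBigO_one ℝ)
  have f0 := expansion_zero hid (hV.of_le (by norm_num)) e0
  have hd1 : ∀ t ∈ Set.Icc (0 : ℝ) τ, HasDerivWithinAt (fun t => z t - z₀ - t • V z₀)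
      (V (z t) - V z₀) (Set.Icc (0 : ℝ) τ) t := fun t ht => by
    simpa using (hd0 t ht).fun_sub (hpow 0 (V z₀) t)
  have e1 := isBigO_pow_succ_of_hasDerivWithinAt hτ (k := 1) hd1 (by simp [hz0]) (by simpa using f0)
  have f1 := expansion_one hid (hV.of_le (by norm_num)) e1
  have hd2 : ∀ t ∈ Set.Icc (0 : ℝ) τ, HasDerivWithinAt
      (fun t => z t - z₀ - t • V z₀ - t ^ 2 • (1 / 2 : ℝ) • fderiv ℝ V z₀ (V z₀))
      (V (z t) - V z₀ - t • fderiv ℝ V z₀ (V z₀)) (Set.Icc (0 : ℝ) τ) t := fun t ht => by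
    refine ((hd1 t ht).fun_sub (hpow 1 ((1 / 2 : ℝ) • fderiv ℝ V z₀ (V z₀)) t)).congr_deriv ?_
    push_cast
    module
  have e2 := isBigO_pow_succ_of_hasDerivWithinAt hτ (k := 2) hd2 (by simp [hz0]) f1
  have f2 := expansion_two hid hV e2
  refine isBigO_pow_succ_of_hasDerivWithinAt hτ (k := 3) (fun t ht => ?_) (by simp [hz0]) f2
  refine ((hd2 t ht).fun_sub (hpow 2 ((1 / 6 : ℝ) • (fderiv ℝ V z₀ (fderiv ℝ V z₀ (V z₀))
    + fderiv ℝ (fderiv ℝ V) z₀ (V z₀) (V z₀))) t)).congr_deriv ?_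
  push_cast
  rw [map_smul]
  module

end Integration

/-! ### Additive Runge-Kutta methods with common weights -/

section Additive

variable {ι Z : Type*} [Fintype ι] [NormedAddCommGroup Z] [NormedSpace ℝ Z] {s : ℕ}

/-- Stage equations of the additive Runge-Kutta method with matrices `A ν` for the equation
`ż = ∑ ν, V ν z`. -/
def AddStages (A : ι → Fin s → Fin s → ℝ) (V : ι → Z → Z) (z₀ : Z) (h : ℝ) (σ : Fin s → Z) :
    Prop :=
  ∀ i, σ i = z₀ + h • ∑ ν, ∑ j, A ν i j • V ν (σ j)

/-- Update of an additive Runge-Kutta method in which all parts share the weights `w`. -/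
def addStep (w : Fin s → ℝ) (V : ι → Z → Z) (z₀ : Z) (h : ℝ) (σ : Fin s → Z) : Z :=
  z₀ + h • ∑ i, w i • ∑ ν, V ν (σ i)

/-- The order conditions up to order three of an additive Runge-Kutta method with common weights
`w`: one condition for each rooted tree with at most three vertices whose non-root vertices are
coloured by `ι`. -/
structure OrderThree (w : Fin s → ℝ) (A : ι → Fin s → Fin s → ℝ) : Prop where
  one : ∑ i, w i = 1
  two : ∀ ν, ∑ i, w i * ∑ j, A ν i j = 1 / 2
  bushy : ∀ ν μ, ∑ i, w i * ((∑ j, A ν i j) * ∑ j, A μ i j) = 1 / 3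
  tall : ∀ ν μ, ∑ i, w i * ∑ j, A ν i j * ∑ k, A μ j k = 1 / 6

/-- The fixed point equation `σ = e₀ + h Φ(σ)` is solvable near `e₀` for small `h`: the right-hand
side is a contraction of a small ball. -/
theorem eventually_exists_eq_add_smul {E : Type*} [NormedAddCommGroup E] [NormedSpace ℝ E]
    [CompleteSpace E] {Φ : E → E} {e₀ : E} (hΦ : ContDiffAt ℝ 1 Φ e₀) :
    ∀ᶠ r in 𝓝[>] (0 : ℝ), ∀ᶠ h in 𝓝[>] (0 : ℝ), ∃ σ ∈ Metric.closedBall e₀ r,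
      σ = e₀ + h • Φ σ := by
  obtain ⟨K, t, ht, hK⟩ := hΦ.exists_lipschitzOnWith
  obtain ⟨ε, hε, hεt⟩ := Metric.nhds_basis_closedBall.mem_iff.1 ht
  filter_upwards [Ioo_mem_nhdsGT hε] with r hr
  have hrt : Metric.closedBall e₀ r ⊆ t := (Metric.closedBall_subset_closedBall hr.2.le).trans hεt
  have he₀ : e₀ ∈ Metric.closedBall e₀ r := Metric.mem_closedBall_self hr.1.le
  have hsmall : ∀ c a : ℝ, 0 < a → ∀ᶠ h in 𝓝[>] (0 : ℝ), h * c < a := fun c a ha => by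
    have : Tendsto (fun h : ℝ => h * c) (𝓝[>] 0) (𝓝 (0 * c)) :=
      (tendsto_id.mul_const c).mono_left nhdsWithin_le_nhds
    rw [zero_mul] at this
    exact this.eventually_lt_const ha
  filter_upwards [hsmall K (1 / 2) (by norm_num), hsmall (‖Φ e₀‖ + K * r) r hr.1,
    self_mem_nhdsWithin] with h h1 h2 h0
  rw [Set.mem_Ioi] at h0
  set T : E → E := fun σ => e₀ + h • Φ σ with hT
  have hmaps : Set.MapsTo T (Metric.closedBall e₀ r) (Metric.closedBall e₀ r) := fun σ hσ => by
    have h3 : ‖Φ σ - Φ e₀‖ ≤ K * ‖σ - e₀‖ := hK.norm_sub_le (hrt hσ) (hrt he₀)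
    rw [mem_closedBall_iff_norm] at hσ ⊢
    have h4 : ‖Φ σ‖ ≤ ‖Φ e₀‖ + K * r := by
      have h5 := norm_le_norm_add_norm_sub' (Φ σ) (Φ e₀)
      have h6 : K * ‖σ - e₀‖ ≤ K * r := by gcongr
      linarith
    simp only [hT, add_sub_cancel_left, norm_smul, Real.norm_of_nonneg h0.le]
    exact (mul_le_mul_of_nonneg_left h4 h0.le).trans h2.le
  have hcontr : ContractingWith (1 / 2) (hmaps.restrict T _ _) := by
    refine ⟨by rw [← NNReal.coe_lt_coe]; norm_num, LipschitzWith.of_dist_le_mul fun x y => ?_⟩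
    have h3 : ‖Φ x - Φ y‖ ≤ K * ‖(x : E) - y‖ := hK.norm_sub_le (hrt x.2) (hrt y.2)
    rw [Subtype.dist_eq, Subtype.dist_eq, dist_eq_norm, dist_eq_norm]
    simp only [hT, Set.MapsTo.val_restrict_apply, add_sub_add_left_eq_sub, ← smul_sub, norm_smul,
      Real.norm_of_nonneg h0.le]
    calc h * ‖Φ x - Φ y‖ ≤ h * (K * ‖(x : E) - y‖) := by gcongr
      _ = (h * K) * ‖(x : E) - y‖ := by ring
      _ ≤ (1 / 2) * ‖(x : E) - y‖ := by gcongr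
      _ = _ := by norm_num
  obtain ⟨σ, hσ, hfix, -⟩ := hcontr.exists_fixedPoint' Metric.isClosed_closedBall.isComplete hmaps
    he₀ (edist_ne_top _ _)
  exact ⟨σ, hσ, hfix.symm⟩

variable {A : ι → Fin s → Fin s → ℝ} {w : Fin s → ℝ} {V : ι → Z → Z} {z₀ : Z}
  {α : Type*} {l : Filter α} {h : α → ℝ} {σ : α → Fin s → Z}

/-- One insertion into the stage equations gains a power of the step size. -/
theorem isBigO_smul_sum_sum {R : ι → Fin s → α → Z} {k : ℕ}
    (hR : ∀ ν j, R ν j =O[l] fun t => h t ^ k) (i : Fin s) :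
    (fun t => h t • ∑ ν, ∑ j, A ν i j • R ν j t) =O[l] fun t => h t ^ (k + 1) := by
  have h1 : (fun t => ∑ ν, ∑ j, A ν i j • R ν j t) =O[l] fun t => h t ^ k :=
    IsBigO.fun_sum fun ν _ => IsBigO.fun_sum fun j _ => (hR ν j).const_smul_left _
  simpa [pow_succ'] using (isBigO_refl h l).smul h1

/-- The third order expansion of the stages, obtained by inserting the expansions of lower order
into the stage equations repeatedly. -/
theorem stage_expansion (hV : ∀ ν, ContDiffAt ℝ 2 (V ν) z₀) (hh : Tendsto h l (𝓝 0))
    (hσ : ∀ᶠ t in l, AddStages A V z₀ (h t) (σ t))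
    (hb : ∀ ν i, (fun t => V ν (σ t i)) =O[l] fun _ => (1 : ℝ)) (i : Fin s) :
    (fun t => σ t i - z₀ - h t • ∑ ν, (∑ j, A ν i j) • V ν z₀
      - h t ^ 2 • ∑ ν, ∑ j, A ν i j • fderiv ℝ (V ν) z₀ (∑ μ, (∑ k, A μ j k) • V μ z₀))
      =O[l] fun t => h t ^ 3 := by
  have s0 : ∀ j, (fun t => σ t j - z₀) =O[l] h := fun j => by
    have h1 := isBigO_smul_sum_sum (A := A) (h := h) (k := 0) (by simpa using hb) j
    simp only [zero_add, pow_one] at h1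
    refine h1.congr' ?_ EventuallyEq.rfl
    filter_upwards [hσ] with t ht
    rw [ht j, add_sub_cancel_left]
  have s1 : ∀ j, (fun t => σ t j - z₀ - h t • ∑ ν, (∑ k, A ν j k) • V ν z₀)
      =O[l] fun t => h t ^ 2 := fun j => by
    refine (isBigO_smul_sum_sum (A := A) (h := h) (k := 1) (fun ν j => by
      simpa using expansion_zero hh ((hV ν).of_le (by norm_num)) (s0 j)) j).congr' ?_
      EventuallyEq.rfl
    filter_upwards [hσ] with t ht
    rw [ht j, add_sub_cancel_left]
    simp only [smul_sub, Finset.sum_sub_distrib, Finset.sum_smul]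
  refine (isBigO_smul_sum_sum (A := A) (h := h) (fun ν j => expansion_one hh (hV ν) (s1 j))
    i).congr' ?_ EventuallyEq.rfl
  filter_upwards [hσ] with t ht
  rw [ht i, add_sub_cancel_left]
  simp only [smul_sub, Finset.sum_sub_distrib, Finset.sum_smul, pow_two, mul_smul,
    Finset.smul_sum, smul_comm (h t) (A _ _ _)]

/-- Under the order conditions the update has the Taylor polynomial of the exact solution. -/
theorem addStep_expansion (hA : OrderThree w A) (hV : ∀ ν, ContDiffAt ℝ 3 (V ν) z₀)
    (hh : Tendsto h l (𝓝 0)) (hσ : ∀ᶠ t in l, AddStages A V z₀ (h t) (σ t))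
    (hb : ∀ ν i, (fun t => V ν (σ t i)) =O[l] fun _ => (1 : ℝ))
    {F : Z → Z} (hF : F = fun z => ∑ ν, V ν z) :
    (fun t => addStep w V z₀ (h t) (σ t) - z₀ - h t • F z₀
      - h t ^ 2 • (1 / 2 : ℝ) • fderiv ℝ F z₀ (F z₀)
      - h t ^ 3 • (1 / 6 : ℝ) • (fderiv ℝ F z₀ (fderiv ℝ F z₀ (F z₀))
        + fderiv ℝ (fderiv ℝ F) z₀ (F z₀) (F z₀))) =O[l] fun t => h t ^ 4 := by
  have hF3 : ContDiffAt ℝ 3 F z₀ := hF ▸ ContDiffAt.sum fun ν _ => hV ν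
  have hF0 : F z₀ = ∑ ν, V ν z₀ := by rw [hF]
  have hF' : ∀ v, fderiv ℝ F z₀ v = ∑ ν, fderiv ℝ (V ν) z₀ v := fun v => by
    rw [hF, fderiv_fun_sum fun ν _ => (hV ν).differentiableAt (by simp)]
    simp
  set a : Fin s → Z := fun i => ∑ ν, (∑ j, A ν i j) • V ν z₀ with ha
  set b : Fin s → Z := fun i => ∑ ν, ∑ j, A ν i j • fderiv ℝ (V ν) z₀ (a j) with hbdef
  have hwa : ∑ i, w i • a i = (1 / 2 : ℝ) • F z₀ := by
    simp only [ha, Finset.smul_sum, smul_smul, hF0]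
    rw [Finset.sum_comm]
    simp only [← Finset.sum_smul, hA.two]
  have hwb : ∑ i, w i • b i = (1 / 6 : ℝ) • fderiv ℝ F z₀ (F z₀) := by
    have h1 : ∀ i, w i • b i = ∑ ν, ∑ μ, (w i * ∑ j, A ν i j * ∑ k, A μ j k) •
        fderiv ℝ (V ν) z₀ (V μ z₀) := fun i => by
      simp only [hbdef, ha, map_sum, map_smul, Finset.smul_sum, smul_smul]
      refine Finset.sum_congr rfl fun ν _ => ?_
      rw [Finset.sum_comm]
      refine Finset.sum_congr rfl fun μ _ => ?_
      rw [← Finset.sum_smul, ← Finset.mul_sum]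
    simp only [h1]
    rw [Finset.sum_comm]
    simp only [hF', hF0, map_sum, Finset.smul_sum]
    refine Finset.sum_congr rfl fun ν _ => ?_
    rw [Finset.sum_comm]
    simp only [← Finset.sum_smul, hA.tall]
  have hwaa : ∑ i, w i • fderiv ℝ (fderiv ℝ F) z₀ (a i) (a i)
      = (1 / 3 : ℝ) • fderiv ℝ (fderiv ℝ F) z₀ (F z₀) (F z₀) := by
    have h1 : ∀ i, w i • fderiv ℝ (fderiv ℝ F) z₀ (a i) (a i) = ∑ ν, ∑ μ,
        (w i * ((∑ j, A ν i j) * ∑ j, A μ i j)) •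
          fderiv ℝ (fderiv ℝ F) z₀ (V ν z₀) (V μ z₀) := fun i => by
      simp only [ha, map_sum, map_smul, sum_apply, smul_apply, Finset.smul_sum, smul_smul]
      rw [Finset.sum_comm]
      refine Finset.sum_congr rfl fun ν _ => Finset.sum_congr rfl fun μ _ => ?_
      congr 1
      ring
    simp only [h1]
    rw [Finset.sum_comm]
    simp only [hF0, map_sum, sum_apply, Finset.smul_sum]
    conv_rhs => rw [Finset.sum_comm]
    refine Finset.sum_congr rfl fun ν _ => ?_
    rw [Finset.sum_comm]
    simp only [← Finset.sum_smul, hA.bushy]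
  have key : (fun t => h t • ∑ i, w i • (F (σ t i) - F z₀ - h t • fderiv ℝ F z₀ (a i) - h t ^ 2 •
      (fderiv ℝ F z₀ (b i) + (1 / 2 : ℝ) • fderiv ℝ (fderiv ℝ F) z₀ (a i) (a i))))
      =O[l] fun t => h t ^ 4 := by
    have h1 := fun i => expansion_two hh hF3
      (stage_expansion (fun ν => (hV ν).of_le (by norm_num)) hh hσ hb i)
    have h2 := (isBigO_refl h l).smul
      (IsBigO.fun_sum (s := Finset.univ) fun i _ => (h1 i).const_smul_left (w i))
    exact h2.congr (fun t => rfl) fun t => (pow_succ' (h t) 3).symm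
  refine key.congr_left fun t => ?_
  have hsum : ∑ i, w i • (F (σ t i) - F z₀ - h t • fderiv ℝ F z₀ (a i) - h t ^ 2 •
      (fderiv ℝ F z₀ (b i) + (1 / 2 : ℝ) • fderiv ℝ (fderiv ℝ F) z₀ (a i) (a i)))
      = ∑ i, w i • F (σ t i) - (∑ i, w i) • F z₀ - h t • fderiv ℝ F z₀ (∑ i, w i • a i)
        - h t ^ 2 • (fderiv ℝ F z₀ (∑ i, w i • b i)
          + (1 / 2 : ℝ) • ∑ i, w i • fderiv ℝ (fderiv ℝ F) z₀ (a i) (a i)) := by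
    simp only [map_sum, map_smul, Finset.smul_sum, Finset.sum_smul, smul_add, smul_sub,
      Finset.sum_sub_distrib, Finset.sum_add_distrib, smul_comm (w _) (h t),
      smul_comm (w _) (h t ^ 2), smul_comm (w _) (1 / 2 : ℝ)]
  rw [hsum, hwa, hwb, hwaa, hA.one]
  simp only [addStep, hF, map_smul]
  module

/-- An additive Runge-Kutta method whose coefficients satisfy the order conditions has order three
at every point near which the vector fields are `C³`. -/
theorem OrderThree.hasLocalOrder {Z : Type} [NormedAddCommGroup Z] [NormedSpace ℝ Z]
    [CompleteSpace Z] {V : ι → Z → Z} {z₀ : Z} (hA : OrderThree w A)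
    (hV : ∀ ν, ContDiffAt ℝ 3 (V ν) z₀) :
    HasLocalOrder 3 (fun z => ∑ ν, V ν z) z₀ (AddStages A V z₀) (addStep w V z₀) := by
  intro τ z hτ hz0 hz
  have hΦ : ContDiffAt ℝ 1 (fun (σ : Fin s → Z) i => ∑ ν, ∑ j, A ν i j • V ν (σ j))
      (fun _ => z₀) := by
    refine contDiffAt_pi.2 fun i => ContDiffAt.sum fun ν _ => ContDiffAt.sum fun j _ =>
      contDiffAt_const.smul ?_
    exact ((hV ν).of_le (by norm_num)).comp (fun _ : Fin s => z₀)
      (contDiff_apply ℝ Z j).contDiffAt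
  have hbdd : ∀ᶠ r in 𝓝[>] (0 : ℝ), ∀ ν, ∃ C, ∀ x ∈ Metric.closedBall z₀ r, ‖V ν x‖ ≤ C := by
    refine eventually_all.2 fun ν => ?_
    have h1 : (V ν) =O[𝓝 z₀] fun _ => (1 : ℝ) := (hV ν).continuousAt.tendsto.isBigO_one ℝ
    obtain ⟨C, hC⟩ := h1.bound
    obtain ⟨ε, hε, hεC⟩ := Metric.nhds_basis_closedBall.mem_iff.1 hC
    filter_upwards [Ioo_mem_nhdsGT hε] with r hr
    exact ⟨C, fun x hx => by simpa using hεC (Metric.closedBall_subset_closedBall hr.2.le hx)⟩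
  obtain ⟨r, hex, hbd, hr⟩ := ((eventually_exists_eq_add_smul hΦ).and
    (hbdd.and self_mem_nhdsWithin)).exists
  replace hr : 0 < r := hr
  -- `l` is the filter of pairs (step size, solution of the stage equations in the ball), `h → 0⁺`.
  set l : Filter (ℝ × (Fin s → Z)) := comap Prod.fst (𝓝[>] 0) ⊓
    𝓟 {x | x.2 ∈ Metric.closedBall (fun _ : Fin s => z₀) r ∧ AddStages A V z₀ x.1 x.2} with hl
  have hfst : Tendsto Prod.fst l (𝓝[>] (0 : ℝ)) := tendsto_comap.mono_left inf_le_left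
  have hmem : ∀ᶠ x in l, x.2 ∈ Metric.closedBall (fun _ : Fin s => z₀) r ∧
      AddStages A V z₀ x.1 x.2 := mem_inf_of_right (mem_principal_self _)
  have hnum := addStep_expansion hA hV (hfst.mono_right nhdsWithin_le_nhds)
    (hmem.mono fun _ hx => hx.2) (fun ν i => by
      obtain ⟨C, hC⟩ := hbd ν
      refine IsBigO.of_bound C ?_
      filter_upwards [hmem] with x hx
      simpa using hC _ ((dist_pi_le_iff hr.le).1 hx.1 i)) rfl
  have hexact := (exact_expansion (ContDiffAt.sum fun ν _ => hV ν) hτ hz0 hz).comp_tendsto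
    (hfst.mono_right (nhdsWithin_mono _ Set.Ioi_subset_Ici_self))
  obtain ⟨C, hC⟩ := (hexact.sub hnum).bound
  rw [hl, eventually_inf_principal, eventually_comap] at hC
  obtain ⟨h₀, hh₀, hlt⟩ := mem_nhdsGT_iff_exists_Ioc_subset.1 (hC.and (hex.and (Ioc_mem_nhdsGT hτ)))
  rw [Set.mem_Ioi] at hh₀
  refine ⟨r, h₀, C, hr, hh₀, (hlt (Set.right_mem_Ioc.2 hh₀)).2.2.2, fun h h0 hle => ?_⟩
  obtain ⟨hbound, ⟨σ, hσ, hσeq⟩, -⟩ := hlt ⟨h0, hle⟩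
  refine ⟨⟨σ, hσ, fun i => congrFun hσeq i⟩, fun σ hσ hst => ?_⟩
  have h1 := hbound (h, σ) rfl ⟨hσ, hst⟩
  simp only [Function.comp_apply, norm_pow, Real.norm_of_nonneg h0.le] at h1
  refine le_of_eq_of_le (congrArg norm ?_) h1
  module

end Additive

/-! ### Order conditions of the adjoint coefficients -/

/-- The coefficients `w_j - w_j a_ji / w_i` used for the costates when `a` is used for the states:
they make the resulting partitioned method symplectic. -/
noncomputable def adjointCoeff {s : ℕ} (w : Fin s → ℝ) (a : Fin s → Fin s → ℝ) (i j : Fin s) : ℝ :=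
  w j - w j / w i * a j i

section Adjoint

variable {ι : Type*} {s : ℕ} {w : Fin s → ℝ} {A : ι → Fin s → Fin s → ℝ}

theorem sum_adjointCoeff (hw : ∑ i, w i = 1) (a : Fin s → Fin s → ℝ) (i : Fin s) :
    ∑ j, adjointCoeff w a i j = 1 - (∑ j, w j * a j i) / w i := by
  simp only [adjointCoeff, Finset.sum_sub_distrib, hw, Finset.sum_div]
  congr 1
  exact Finset.sum_congr rfl fun j _ => by ring

theorem sum_mul_sum_eq (w : Fin s → ℝ) (a : Fin s → Fin s → ℝ) (X : Fin s → ℝ) :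
    ∑ i, w i * ∑ j, a i j * X j = ∑ j, (∑ i, w i * a i j) * X j := by
  simp only [Finset.mul_sum, Finset.sum_mul]
  rw [Finset.sum_comm]
  simp only [mul_assoc]

theorem sum_mul_sum_adjointCoeff (hne : ∀ i, w i ≠ 0) (hw : ∑ i, w i = 1)
    (a : Fin s → Fin s → ℝ) (X : Fin s → ℝ) :
    ∑ i, w i * ∑ j, adjointCoeff w a i j * X j
      = ∑ j, w j * X j - ∑ j, w j * ((∑ k, a j k) * X j) := by
  rw [sum_mul_sum_eq, ← Finset.sum_sub_distrib]
  refine Finset.sum_congr rfl fun j _ => ?_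
  have h1 : ∀ i, w i * adjointCoeff w a i j = w i * w j - w j * a j i := fun i => by
    have := hne i
    rw [adjointCoeff]
    field_simp
  simp only [h1, Finset.sum_sub_distrib, ← Finset.sum_mul, ← Finset.mul_sum, hw]
  ring

/-- Adding the adjoint matrices to a family satisfying the order conditions yields only one new
condition, the hypothesis `hD`. It arises from the tree with two leaves at the root, both coloured
by adjoint matrices, and from the path whose inner vertex has an original and whose leaf has an
adjoint colour. -/
theorem OrderThree.sum_elim_adjointCoeff (hA : OrderThree w A) (hne : ∀ i, w i ≠ 0)
    (hD : ∀ ν μ, ∑ j, (∑ i, w i * A ν i j) * (∑ i, w i * A μ i j) / w j = 1 / 3) :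
    OrderThree w (Sum.elim A fun ν => adjointCoeff w (A ν)) := by
  have hw := hA.one
  have d1 : ∀ ν, ∑ j, ∑ i, w i * A ν i j = 1 / 2 := fun ν => by
    have := sum_mul_sum_eq w (A ν) 1
    simp only [Pi.one_apply, mul_one, hA.two] at this
    exact this.symm
  have dc : ∀ ν μ, ∑ j, (∑ i, w i * A ν i j) * ∑ k, A μ j k = 1 / 6 := fun ν μ => by
    rw [← sum_mul_sum_eq, hA.tall]
  -- The row sums of an adjoint matrix are `1 - (∑ j, w j * A ν j i) / w i`.
  have r1 : ∀ ν i, w i * (1 - (∑ j, w j * A ν j i) / w i) = w i - ∑ j, w j * A ν j i :=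
    fun ν i => by have := hne i; field_simp
  have two' : ∀ ν, ∑ i, w i * (1 - (∑ j, w j * A ν j i) / w i) = 1 / 2 := fun ν => by
    simp only [r1, Finset.sum_sub_distrib, hw, d1]; norm_num
  have mixed : ∀ ν μ, ∑ i, w i * ((∑ k, A ν i k) * (1 - (∑ j, w j * A μ j i) / w i)) = 1 / 3 :=
    fun ν μ => by
      have h1 : ∀ i, w i * ((∑ k, A ν i k) * (1 - (∑ j, w j * A μ j i) / w i))
          = w i * ∑ k, A ν i k - (∑ j, w j * A μ j i) * ∑ k, A ν i k := fun i => by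
        rw [mul_left_comm, r1]; ring
      simp only [h1, Finset.sum_sub_distrib, hA.two, dc]; norm_num
  have adj : ∀ ν μ, ∑ i, w i * ((1 - (∑ j, w j * A ν j i) / w i) *
      (1 - (∑ j, w j * A μ j i) / w i)) = 1 / 3 := fun ν μ => by
    have h1 : ∀ i, w i * ((1 - (∑ j, w j * A ν j i) / w i) * (1 - (∑ j, w j * A μ j i) / w i))
        = w i - (∑ j, w j * A ν j i) - (∑ j, w j * A μ j i)
          + (∑ j, w j * A ν j i) * (∑ j, w j * A μ j i) / w i := fun i => by
      have := hne i; field_simp; ring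
    simp only [h1, Finset.sum_add_distrib, Finset.sum_sub_distrib, hw, d1, hD]; norm_num
  have dadj : ∀ ν μ, ∑ j, (∑ i, w i * A ν i j) * (1 - (∑ i, w i * A μ i j) / w j) = 1 / 6 :=
    fun ν μ => by
      simp only [mul_sub, mul_one, ← mul_div_assoc, Finset.sum_sub_distrib, d1, hD]; norm_num
  refine ⟨hw, ?_, ?_, ?_⟩
  · rintro (ν | ν)
    · exact hA.two ν
    · simpa only [Sum.elim_inr, sum_adjointCoeff hw] using two' ν
  · rintro (ν | ν) (μ | μ) <;> simp only [Sum.elim_inr, Sum.elim_inl, sum_adjointCoeff hw]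
    · exact hA.bushy ν μ
    · exact mixed ν μ
    · simpa only [mul_comm] using mixed μ ν
    · exact adj ν μ
  · rintro (ν | ν) (μ | μ) <;> simp only [Sum.elim_inr, Sum.elim_inl, sum_adjointCoeff hw]
    · exact hA.tall ν μ
    · rw [sum_mul_sum_eq, dadj]
    · rw [sum_mul_sum_adjointCoeff hne hw, hA.two, hA.bushy]; norm_num
    · rw [sum_mul_sum_adjointCoeff hne hw, two', mixed]; norm_num

end Adjoint

/-! ### Necessity of the order conditions -/

section Necessity

theorem eq_of_abs_mul_pow_le {x y h₀ C : ℝ} {k : ℕ} (hk : k ≤ 3) (hh₀ : 0 < h₀)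
    (hle : ∀ h, 0 < h → h ≤ h₀ → |x * h ^ k - y * h ^ k| ≤ C * h ^ 4) : x = y := by
  obtain ⟨j, hj⟩ := Nat.exists_eq_add_of_le hk
  have hlim : Tendsto (fun h : ℝ => C * h ^ (j + 1)) (𝓝[>] 0) (𝓝 0) := by
    have : Tendsto (fun h : ℝ => C * h ^ (j + 1)) (𝓝 0) (𝓝 (C * 0 ^ (j + 1))) :=
      (tendsto_id.pow (j + 1)).const_mul C
    simpa using this.mono_left nhdsWithin_le_nhds
  have h1 : |x - y| ≤ 0 := ge_of_tendsto hlim <| by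
    filter_upwards [Ioc_mem_nhdsGT hh₀] with h hh
    have h2 := hle h hh.1 hh.2
    rw [← sub_mul, abs_mul, abs_of_pos (pow_pos hh.1 k), show 4 = (j + 1) + k by omega, pow_add,
      ← mul_assoc] at h2
    exact le_of_mul_le_mul_right h2 (pow_pos hh.1 k)
  exact sub_eq_zero.1 (abs_nonpos_iff.1 h1)

theorem hasDerivWithinAt_vec {n : ℕ} {x : ℝ → Vec n} {x' : Vec n} {S : Set ℝ} {t : ℝ}
    (hx : ∀ i, HasDerivWithinAt (fun t => x t i) (x' i) S t) : HasDerivWithinAt x x' S t := by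
  rw [hasDerivWithinAt_iff_hasFDerivWithinAt, hasFDerivWithinAt_euclidean]
  intro i
  exact (hx i).hasFDerivWithinAt.congr_fderiv (by ext; simp)

variable {s : ℕ} {M : ImexRK s}

/-- The identities forced by the test equation `ẏ₀ = a + a'`, `ẏ₁ = (b + b') y₀`, `ẏ₂ = y₁`,
`ẏ₃ = y₀²`, where `a` and `b` belong to `F`, `a'` and `b'` to `G`. Its solutions and the stages of
the method are polynomials in time and in the step size, so their coefficients can be compared. -/
theorem ImexRK.HasOrder.conditions (hM : M.HasOrder 3) (hw : ∀ i, M.wI i = M.wE i)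
    (a a' b b' : ℝ) :
    (∑ i, M.wI i) * (a + a') = a + a' ∧
    ∑ i, M.wI i * (b + b') * (∑ j, M.aE i j * a + ∑ j, M.aI i j * a')
      = (b + b') * (a + a') / 2 ∧
    ∑ i, M.wI i * (∑ j, M.aE i j * (b * (∑ k, M.aE j k * a + ∑ k, M.aI j k * a'))
      + ∑ j, M.aI i j * (b' * (∑ k, M.aE j k * a + ∑ k, M.aI j k * a')))
      = (b + b') * (a + a') / 6 ∧
    ∑ i, M.wI i * (∑ j, M.aE i j * a + ∑ j, M.aI i j * a') ^ 2 = (a + a') ^ 2 / 3 := by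
  set F : Vec 4 → Vec 4 := fun y => !₂[a, b * y 0, y 1, y 0 ^ 2] with hF
  set G : Vec 4 → Vec 4 := fun y => !₂[a', b' * y 0, 0, 0] with hG
  set p : Fin s → ℝ := fun i => ∑ j, M.aE i j * a + ∑ j, M.aI i j * a' with hp
  have hFc : ContDiff ℝ ∞ F := contDiff_euclidean.2 fun i => by
    fin_cases i <;> simp [hF] <;> fun_prop
  have hGc : ContDiff ℝ ∞ G := contDiff_euclidean.2 fun i => by
    fin_cases i <;> simp [hG] <;> fun_prop
  obtain ⟨r, h₀, C, -, hh₀, -, hall⟩ := hM 4 F G hFc hGc 0 1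
    (fun t => !₂[(a + a') * t ^ 1, (b + b') * (a + a') / 2 * t ^ 2,
      (b + b') * (a + a') / 6 * t ^ 3, (a + a') ^ 2 / 3 * t ^ 3]) one_pos
    (by ext i; fin_cases i <;> simp)
    (fun t _ => by
      refine hasDerivWithinAt_vec fun i => HasDerivAt.hasDerivWithinAt ?_
      have hpow : ∀ (c : ℝ) (k : ℕ), HasDerivAt (fun t : ℝ => c * t ^ k)
        (c * (k * t ^ (k - 1))) t := fun c k => (hasDerivAt_pow k t).const_mul c
      fin_cases i
      · simpa [hF, hG] using hpow (a + a') 1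
      · refine (hpow _ 2).congr_deriv ?_
        simp [hF, hG]; ring
      · refine (hpow _ 3).congr_deriv ?_
        simp [hF, hG]; ring
      · refine (hpow _ 3).congr_deriv ?_
        simp [hF, hG]; ring)
  -- In these coordinates the stage equations are solved by recursion.
  have hcoord : ∀ h, 0 < h → h ≤ h₀ → ∃ y : Vec 4,
      (∀ k, |!₂[(a + a') * h ^ 1, (b + b') * (a + a') / 2 * h ^ 2,
        (b + b') * (a + a') / 6 * h ^ 3, (a + a') ^ 2 / 3 * h ^ 3] k - y k| ≤ C * h ^ 4) ∧
      y 0 = (∑ i, M.wI i) * (a + a') * h ^ 1 ∧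
      y 1 = (∑ i, M.wI i * (b + b') * p i) * h ^ 2 ∧
      y 2 = (∑ i, M.wI i * (∑ j, M.aE i j * (b * p j) + ∑ j, M.aI i j * (b' * p j))) * h ^ 3 ∧
      y 3 = (∑ i, M.wI i * p i ^ 2) * h ^ 3 := by
    intro h h0 hle
    obtain ⟨⟨σ, hσ, hst⟩, hbd⟩ := hall h h0 hle
    have e0 : ∀ i, σ i 0 = h * p i := fun i => by
      have := congrArg (fun y : Vec 4 => y 0) (hst i)
      simp [hF, hG] at this
      rw [this]
      ring
    have e1 : ∀ i, σ i 1 = h * ∑ j, M.aE i j * (b * (h * p j))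
        + h * ∑ j, M.aI i j * (b' * (h * p j)) := fun i => by
      have := congrArg (fun y : Vec 4 => y 1) (hst i)
      simpa [hF, hG, e0] using this
    refine ⟨M.stateStep F G 0 h σ, fun k => ?_, ?_, ?_, ?_, ?_⟩
    · have h1 := (PiLp.norm_apply_le _ k).trans (hbd σ hσ hst)
      simpa using h1
    · simp [ImexRK.stateStep, hF, hG, ← hw]
      simp only [← Finset.sum_mul]
      ring
    · simp [ImexRK.stateStep, hF, hG, ← hw, e0]
      simp only [Finset.mul_sum, Finset.sum_mul, ← Finset.sum_add_distrib]
      exact Finset.sum_congr rfl fun i _ => by ring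
    · simp [ImexRK.stateStep, hF, hG, ← hw, e1]
      simp only [Finset.mul_sum, Finset.sum_mul, ← Finset.sum_add_distrib]
      refine Finset.sum_congr rfl fun i _ => Finset.sum_congr rfl fun j _ => by ring
    · simp [ImexRK.stateStep, hF, hG, ← hw, e0]
      simp only [Finset.mul_sum, Finset.sum_mul]
      exact Finset.sum_congr rfl fun i _ => by ring
  refine ⟨(eq_of_abs_mul_pow_le (C := C) (k := 1) (by norm_num) hh₀ fun h h0 hle => ?_).symm,
    (eq_of_abs_mul_pow_le (C := C) (k := 2) (by norm_num) hh₀ fun h h0 hle => ?_).symm,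
    (eq_of_abs_mul_pow_le (C := C) (k := 3) (by norm_num) hh₀ fun h h0 hle => ?_).symm,
    (eq_of_abs_mul_pow_le (C := C) (k := 3) (by norm_num) hh₀ fun h h0 hle => ?_).symm⟩ <;>
    obtain ⟨y, hy, y0, y1, y2, y3⟩ := hcoord h h0 hle
  · rw [← y0]; exact hy 0
  · rw [← y1]; exact hy 1
  · rw [← y2]; exact hy 2
  · rw [← y3]; exact hy 3

/-- The `f`- and `g`-matrices of the method, indexed by `Fin 2`. -/
def ImexRK.matrices (M : ImexRK s) : Fin 2 → Fin s → Fin s → ℝ := ![M.aE, M.aI]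

/-- The coloured trees are separated by choosing the parameters of the test equation in `{0, 1}`;
the tree with one leaf of each colour comes from `a = a' = 1` by polarization. -/
theorem ImexRK.HasOrder.orderThree (hM : M.HasOrder 3) (hw : ∀ i, M.wI i = M.wE i) :
    OrderThree M.wI M.matrices := by
  have hc := hM.conditions hw
  have h10 := fun b b' => hc 1 0 b b'
  have h01 := fun b b' => hc 0 1 b b'
  simp only [mul_one, mul_zero, Finset.sum_const_zero, add_zero, zero_add] at h10 h01
  refine ⟨(h10 0 0).1, ?_, ?_, ?_⟩
  · intro ν
    fin_cases ν
    · simpa [ImexRK.matrices] using (h10 1 0).2.1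
    · simpa [ImexRK.matrices] using (h01 1 0).2.1
  · have hEE := (h10 0 0).2.2.2
    have hII := (h01 0 0).2.2.2
    have hEI : ∑ i, M.wI i * ((∑ j, M.aE i j) * ∑ j, M.aI i j) = 1 / 3 := by
      have h11 := (hc 1 1 0 0).2.2.2
      have h1 : ∀ x y z : ℝ, x * (y + z) ^ 2 = x * y ^ 2 + 2 * (x * (y * z)) + x * z ^ 2 :=
        fun x y z => by ring
      simp only [mul_one, h1, Finset.sum_add_distrib, ← Finset.mul_sum] at h11
      linarith
    intro ν μ
    fin_cases ν <;> fin_cases μ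
    · simpa [ImexRK.matrices, pow_two] using hEE
    · simpa [ImexRK.matrices] using hEI
    · simpa [ImexRK.matrices, mul_comm] using hEI
    · simpa [ImexRK.matrices, pow_two] using hII
  · intro ν μ
    fin_cases ν <;> fin_cases μ
    · simpa [ImexRK.matrices] using (h10 1 0).2.2.1
    · simpa [ImexRK.matrices] using (h01 1 0).2.2.1
    · simpa [ImexRK.matrices] using (h10 0 1).2.2.1
    · simpa [ImexRK.matrices] using (h01 0 1).2.2.1

end Necessity

/-! ### The extended Hamiltonian system -/

section Extended

variable {n m : ℕ}

/-- The extended field as a sum of four parts, one for each coefficient matrix of the additive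
method: `inl 0` and `inl 1` are `f` and `g` in the equation for `y`, advanced with `ã` and `a`;
`inr 0` and `inr 1` are the equations for `p̃` and `p`, advanced with their adjoints. Since the
weights agree, `α̃ = α` and `β̃ = β`, so the `f`- and `g`-terms of a costate equation need not be
separated. -/
noncomputable def extPart (f g : Vec n → Vec m → Vec n) (φ : Ext n → Vec m) :
    Fin 2 ⊕ Fin 2 → Ext n → Ext n :=
  Sum.elim
    ![fun z => (f z.1 (φ z), 0, 0), fun z => (g z.1 (φ z), 0, 0)]
    ![fun z => (0, - jacT f z.1 (φ z) z.2.1 - jacT g z.1 (φ z) z.2.2, 0),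
      fun z => (0, 0, - jacT f z.1 (φ z) z.2.1 - jacT g z.1 (φ z) z.2.2)]

theorem sum_extPart (f g : Vec n → Vec m → Vec n) (φ : Ext n → Vec m) (z : Ext n) :
    ∑ ν, extPart f g φ ν z = extField f g φ z := by
  simp [extPart, extField, Fintype.sum_sum_type]

/-- The Jacobian is first shown to be `C³` jointly in `(y, u)` and then composed with `φ`:
differentiating `f(x, φ z)` jointly in `(x, z)` would require `φ` to be `C⁴`. -/
theorem contDiffAt_jacT {f : Vec n → Vec m → Vec n} {φ : Ext n → Vec m} {p : Ext n → Vec n}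
    {z₀ : Ext n} (hf : ContDiffAt ℝ 4 (fun x : Vec n × Vec m => f x.1 x.2) (z₀.1, φ z₀))
    (hφ : ContDiffAt ℝ 3 φ z₀) (hp : ContDiffAt ℝ 3 p z₀) :
    ContDiffAt ℝ 3 (fun z => jacT f z.1 (φ z) (p z)) z₀ := by
  have h1 : ContDiffAt ℝ 3 (fun q : Vec n × Vec m => fderiv ℝ (fun x => f x q.2) q.1)
      (z₀.1, φ z₀) := by
    refine ContDiffAt.fderiv (n := 4) (f := fun (q : Vec n × Vec m) x => f x q.2) (g := Prod.fst)
      ?_ contDiffAt_fst (by norm_num)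
    exact ContDiffAt.comp (f := fun x : (Vec n × Vec m) × Vec n => (x.2, x.1.2))
      ((z₀.1, φ z₀), z₀.1) hf (by fun_prop)
  have h2 := ContDiffAt.comp (f := fun z : Ext n => (z.1, φ z)) z₀ h1 (contDiffAt_fst.prodMk hφ)
  exact (((ContinuousLinearMap.adjoint (𝕜 := ℝ) (E := Vec n) (F := Vec n)).toContinuousLinearEquiv
    ).contDiff.contDiffAt.comp z₀ h2).clm_apply hp

theorem contDiffAt_extPart {f g : Vec n → Vec m → Vec n} {φ : Ext n → Vec m} {z₀ : Ext n}
    (hf : ContDiffAt ℝ 4 (fun x : Vec n × Vec m => f x.1 x.2) (z₀.1, φ z₀))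
    (hg : ContDiffAt ℝ 4 (fun x : Vec n × Vec m => g x.1 x.2) (z₀.1, φ z₀))
    (hφ : ContDiffAt ℝ 3 φ z₀) (ν : Fin 2 ⊕ Fin 2) : ContDiffAt ℝ 3 (extPart f g φ ν) z₀ := by
  have hstate : ∀ {f : Vec n → Vec m → Vec n},
      ContDiffAt ℝ 4 (fun x : Vec n × Vec m => f x.1 x.2) (z₀.1, φ z₀) →
      ContDiffAt ℝ 3 (fun z : Ext n => f z.1 (φ z)) z₀ := fun hf =>
    ContDiffAt.comp (f := fun z : Ext n => (z.1, φ z)) z₀ (hf.of_le (by norm_num))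
      (contDiffAt_fst.prodMk hφ)
  have hcostate : ContDiffAt ℝ 3
      (fun z : Ext n => - jacT f z.1 (φ z) z.2.1 - jacT g z.1 (φ z) z.2.2) z₀ :=
    (contDiffAt_jacT hf hφ contDiffAt_snd.fst).neg.sub (contDiffAt_jacT hg hφ contDiffAt_snd.snd)
  rcases ν with ν | ν <;> fin_cases ν
  · exact (hstate hf).prodMk contDiffAt_const
  · exact (hstate hg).prodMk contDiffAt_const
  · exact contDiffAt_const.prodMk (hcostate.prodMk contDiffAt_const)
  · exact contDiffAt_const.prodMk (contDiffAt_const.prodMk hcostate)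

variable {s : ℕ} {M : ImexRK s}

theorem extStages_iff_addStages (hw : ∀ i, M.wI i = M.wE i) (f g : Vec n → Vec m → Vec n)
    (φ : Ext n → Vec m) (z₀ : Ext n) (h : ℝ) (σ : Fin s → Ext n) :
    M.ExtStages f g φ z₀ h σ ↔
      AddStages (Sum.elim M.matrices fun ν => adjointCoeff M.wI (M.matrices ν))
        (extPart f g φ) z₀ h σ := by
  have hw' : M.wE = M.wI := funext fun i => (hw i).symm
  refine forall_congr' fun i => ?_
  simp [Prod.ext_iff, ImexRK.matrices, extPart, Fintype.sum_sum_type, Prod.fst_sum, Prod.snd_sum,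
    ImexRK.alphaE, ImexRK.alphaI, ImexRK.betaE, ImexRK.betaI, adjointCoeff, hw',
    Finset.sum_add_distrib, smul_add, add_assoc, sub_eq_add_neg]

theorem extStep_eq_addStep (hw : ∀ i, M.wI i = M.wE i) (f g : Vec n → Vec m → Vec n)
    (φ : Ext n → Vec m) (z₀ : Ext n) (h : ℝ) (σ : Fin s → Ext n) :
    M.extStep f g φ z₀ h σ = addStep M.wI (extPart f g φ) z₀ h σ := by
  have hw' : M.wE = M.wI := funext fun i => (hw i).symm
  simp only [addStep, sum_extPart]
  simp [extField, ImexRK.extStep, Prod.ext_iff, Prod.fst_sum, Prod.snd_sum, hw',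
    Finset.sum_add_distrib, smul_add, add_assoc, sub_eq_add_neg]

end Extended

end ImexOrder

theorem theorem3p1 {s : ℕ} (M : ImexOrder.ImexRK s)
    (hne : ∀ i, M.wI i ≠ 0)
    (hw : ∀ i, M.wI i = M.wE i)
    (hdiag : M.DiagonallyImplicit)
    (horder : M.HasOrder 3)
    (hdd : ∑ i, M.d i ^ 2 / M.wI i = 1 / 3)
    (hee : ∑ i, M.e i ^ 2 / M.wI i = 1 / 3)
    (hde : ∑ i, M.d i * M.e i / M.wI i = 1 / 3) :
    M.ExtHasOrder 3 := by
  have hed : ∑ i, M.e i * M.d i / M.wI i = 1 / 3 := by simpa only [mul_comm] using hde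
  have hA := (horder.orderThree hw).sum_elim_adjointCoeff hne fun ν μ => by
    simp only [pow_two] at hdd hee
    fin_cases ν <;> fin_cases μ
    · exact hdd
    · exact hde
    · exact hed
    · exact hee
  intro n m f g φ z₀ hf hg hφ
  have key := hA.hasLocalOrder fun ν => ImexOrder.contDiffAt_extPart
    (hf.of_le (by norm_num)) (hg.of_le (by norm_num)) hφ ν
  simpa only [ImexOrder.sum_extPart, ← ImexOrder.extStages_iff_addStages hw,
    ← ImexOrder.extStep_eq_addStep hw, ImexOrder.HasLocalOrder] using key
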